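/- Let $\Bbbk$ be a field. A Hopf brace over $\Bbbk$ is a datum $(H,\cdot,\bullet,1,\Delta,\varepsilon,S,T)$ such that $(H,\cdot,1,\Delta,\varepsilon,S)$ and $(H,\bullet,1,\Delta,\varepsilon,T)$ are Hopf algebras over $\Bbbk$ and $$a\bullet(b\cdot c)=(a_{1}\bullet b)\cdot S(a_{2})\cdot(a_{3}\bullet c)\qquad\text{for all }a,b,c\in H ;$$ it is cocommutative if $\Delta$ is cocommutative. Morphisms of Hopf braces are the linear maps that are Hopf algebra maps for both structures. Let $\mathsf{HBR}_{\mathrm{coc}}$ be the category of cocommutative Hopf braces over $\Bbbk$; it has finite products, the binary product being the tensor product over $\Bbbk$ and the terminal object being $\Bbbk$. Let $\mathsf{Ab}(\mathsf{HBR}_{\mathrm{coc}})$ be the category of internal abelian groups in $\mathsf{HBR}_{\mathrm{coc}}$; an object of $\mathsf{HBR}_{\mathrm{coc}}$ is called abelian if it carries the structure of an internal abelian group. **Proposition 4.4.** 1. A cocommutative Hopf brace $(H,\cdot,\bullet)$ is an abelian object of $\mathsf{HBR}_{\mathrm{coc}}$ if and only if $\cdot=\bullet$ and this product is commutative. 2.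 The forgetful functor $\mathsf{Ab}(\mathsf{HBR}_{\mathrm{coc}})\to\mathsf{HBR}_{\mathrm{coc}}$ induces an isomorphism of categories from $\mathsf{Ab}(\mathsf{HBR}_{\mathrm{coc}})$ onto the full subcategory of $\mathsf{HBR}_{\mathrm{coc}}$ whose objects are the cocommutative Hopf braces with $\cdot=\bullet$ commutative. 3. Consequently there is an isomorphism of categories from $\mathsf{Ab}(\mathsf{HBR}_{\mathrm{coc}})$ to the category of commutative and cocommutative Hopf algebras over $\Bbbk$, which sends an abelian object with underlying Hopf brace $(H,\cdot,\bullet)$ to the Hopf algebra $(H,\cdot,1,\Delta,\varepsilon,S)$ and a morphism to its underlying Hopf algebra map. -/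

import Mathlib

universe u

open scoped TensorProduct

/-- A Hopf brace structure on a Hopf algebra `(H, *, 1, Δ, ε, S)` over `k`: a second multiplication
`bullet` and a linear map `T` such that `(H, bullet, 1, Δ, ε, T)` (same underlying coalgebra, same
unit) is again a Hopf algebra, and such that
`bullet a (b * c) = (bullet a₁ b) * S a₂ * (bullet a₃ c)` for all `a b c`. -/
class HopfBrace (k H : Type u) [Field k] [Ring H] [HopfAlgebra k H] where
  /-- the second multiplication -/
  bullet : H →ₗ[k] H →ₗ[k] H
  /-- the antipode of the second Hopf algebra structure -/
  antipodeT : H →ₗ[k] H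
  bullet_assoc : ∀ a b c : H, bullet (bullet a b) c = bullet a (bullet b c)
  one_bullet : ∀ a : H, bullet 1 a = a
  bullet_one : ∀ a : H, bullet a 1 = a
  /-- `ε` is multiplicative for `bullet` -/
  counit_bullet : ∀ a b : H,
    Coalgebra.counit (R := k) (bullet a b)
      = Coalgebra.counit (R := k) a * Coalgebra.counit (R := k) b
  /-- `Δ` is multiplicative for `bullet`:
  `Δ (bullet a b) = ∑ (bullet a₁ b₁) ⊗ (bullet a₂ b₂)` -/
  comul_bullet : ∀ a b : H,
    Coalgebra.comul (R := k) (bullet a b)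
      = TensorProduct.map₂ bullet bullet (Coalgebra.comul (R := k) a) (Coalgebra.comul (R := k) b)
  /-- `∑ bullet (T a₁) a₂ = ε a • 1` -/
  antipodeT_left : ∀ a : H,
    TensorProduct.lift bullet (antipodeT.rTensor H (Coalgebra.comul (R := k) a))
      = Coalgebra.counit (R := k) a • (1 : H)
  /-- `∑ bullet a₁ (T a₂) = ε a • 1` -/
  antipodeT_right : ∀ a : H,
    TensorProduct.lift bullet (antipodeT.lTensor H (Coalgebra.comul (R := k) a))
      = Coalgebra.counit (R := k) a • (1 : H)
  /-- The compatibility condition; the right-hand side is the linear map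
  `x ⊗ (y ⊗ z) ↦ (bullet x b) * (S y * bullet z c)` applied to `∑ a₁ ⊗ (a₂ ⊗ a₃)`. -/
  bullet_mul : ∀ a b c : H,
    bullet a (b * c)
      = LinearMap.mul' k H
          (TensorProduct.map (bullet.flip b)
            (LinearMap.mul' k H ∘ₗ
              TensorProduct.map (HopfAlgebra.antipode k) (bullet.flip c))
            ((Coalgebra.comul (R := k)).lTensor H (Coalgebra.comul (R := k) a)))

namespace HopfBrace

section Instances

variable {k : Type u} [Field k]

/-- The trivial Hopf brace `(H, *, *)` on a Hopf algebra; not an instance. -/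
@[reducible]
noncomputable def ofHopfAlgebra (H : Type u) [Ring H] [HopfAlgebra k H] : HopfBrace k H where
  bullet := LinearMap.mul k H
  antipodeT := HopfAlgebra.antipode k
  bullet_assoc a b c := by simp [mul_assoc]
  one_bullet a := by simp
  bullet_one a := by simp
  counit_bullet a b := by simp
  comul_bullet a b := by
    rw [LinearMap.mul_apply', Bialgebra.comul_mul]
    generalize Coalgebra.comul (R := k) a = x
    generalize Coalgebra.comul (R := k) b = y
    induction x with
    | zero => simp
    | add _ _ h₁ h₂ => simp [add_mul, h₁, h₂]
    | tmul x₁ x₂ =>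
      induction y with
      | zero => simp
      | add _ _ h₁ h₂ => simp only [mul_add, map_add, h₁, h₂]
      | tmul y₁ y₂ => simp
  antipodeT_left a := by
    have := HopfAlgebra.mul_antipode_rTensor_comul_apply (R := k) a
    rw [Algebra.algebraMap_eq_smul_one] at this
    exact this
  antipodeT_right a := by
    have := HopfAlgebra.mul_antipode_lTensor_comul_apply (R := k) a
    rw [Algebra.algebraMap_eq_smul_one] at this
    exact this
  bullet_mul a b c := by
    have key : ∀ y : H, LinearMap.mul' k H
        (TensorProduct.map (HopfAlgebra.antipode k) ((LinearMap.mul k H).flip c)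
          (Coalgebra.comul (R := k) y)) = Coalgebra.counit (R := k) y • c := by
      intro y
      have h₀ := congrArg (· * c) (HopfAlgebra.mul_antipode_rTensor_comul_apply (R := k) y)
      simp only [Algebra.algebraMap_eq_smul_one, smul_mul_assoc, one_mul] at h₀
      rw [← h₀]
      generalize Coalgebra.comul (R := k) y = z
      induction z with
      | zero => simp
      | add _ _ h₁ h₂ => simp only [map_add, add_mul, h₁, h₂]
      | tmul z₁ z₂ => simp [mul_assoc]
    have h₀ := congrArg (TensorProduct.lift
      ((LinearMap.mul k H).compl₁₂ ((LinearMap.mul k H).flip b)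
        (LinearMap.toSpanSingleton k H c))) (Coalgebra.lTensor_counit_comul (R := k) a)
    have h₁ : a * b * c = (LinearMap.mul k H a) (b * c) := by simp [mul_assoc]
    simp only [TensorProduct.lift.tmul, LinearMap.compl₁₂_apply, LinearMap.flip_apply,
      LinearMap.mul_apply', LinearMap.toSpanSingleton_apply, one_smul] at h₀
    rw [← h₁, ← h₀]
    generalize Coalgebra.comul (R := k) a = z
    induction z with
    | zero => simp
    | add _ _ h₁ h₂ => simp only [map_add, h₁, h₂]
    | tmul z₁ z₂ => simp [key]

/-- The unit object: the trivial Hopf brace on the base field. -/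
noncomputable instance instBase : HopfBrace k k := ofHopfAlgebra k

variable {H K : Type u} [Ring H] [HopfAlgebra k H] [HopfBrace k H]
  [Ring K] [HopfAlgebra k K] [HopfBrace k K]

/-- The tensor product of two Hopf braces:
`bullet (h ⊗ l) (h' ⊗ l') = bullet h h' ⊗ bullet l l'` and `T (h ⊗ l) = T h ⊗ T l`. -/
noncomputable instance instTensor : HopfBrace k (H ⊗[k] K) where
  bullet := TensorProduct.map₂ bullet bullet
  antipodeT := TensorProduct.map antipodeT antipodeT
  bullet_assoc a b c := by
    induction a with
    | zero => simp
    | add _ _ h₁ h₂ => simp [h₁, h₂]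
    | tmul a₁ a₂ =>
    induction b with
    | zero => simp
    | add _ _ h₁ h₂ => simp only [map_add, LinearMap.add_apply, h₁, h₂]
    | tmul b₁ b₂ =>
    induction c with
    | zero => simp
    | add _ _ h₁ h₂ => simp only [map_add, h₁, h₂]
    | tmul c₁ c₂ => simp [bullet_assoc]
  one_bullet a := by
    induction a with
    | zero => simp
    | add _ _ h₁ h₂ => simp only [map_add, h₁, h₂]
    | tmul a₁ a₂ => simp [Algebra.TensorProduct.one_def, one_bullet]
  bullet_one a := by
    induction a with
    | zero => simp
    | add _ _ h₁ h₂ => simp only [map_add, LinearMap.add_apply, h₁, h₂]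
    | tmul a₁ a₂ => simp [Algebra.TensorProduct.one_def, bullet_one]
  counit_bullet a b := by
    induction a with
    | zero => simp
    | add _ _ h₁ h₂ => simp only [map_add, LinearMap.add_apply, add_mul, h₁, h₂]
    | tmul a₁ a₂ =>
    induction b with
    | zero => simp
    | add _ _ h₁ h₂ => simp only [map_add, mul_add, h₁, h₂]
    | tmul b₁ b₂ =>
      simp [counit_bullet]
      ring
  comul_bullet a b := by
    induction a with
    | zero => simp
    | add _ _ h₁ h₂ => simp only [map_add, LinearMap.add_apply, h₁, h₂]
    | tmul a₁ a₂ =>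
    induction b with
    | zero => simp
    | add _ _ h₁ h₂ => simp only [map_add, h₁, h₂]
    | tmul b₁ b₂ =>
      simp only [TensorProduct.map₂_apply_tmul, TensorProduct.map_tmul,
        TensorProduct.comul_tmul, comul_bullet]
      generalize Coalgebra.comul (R := k) a₁ = x
      generalize Coalgebra.comul (R := k) a₂ = x'
      generalize Coalgebra.comul (R := k) b₁ = y
      generalize Coalgebra.comul (R := k) b₂ = y'
      induction x with
      | zero => simp
      | add _ _ h₁ h₂ => simp only [map_add, LinearMap.add_apply, TensorProduct.add_tmul, h₁, h₂]
      | tmul x₁ x₂ =>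
      induction x' with
      | zero => simp
      | add _ _ h₁ h₂ => simp only [map_add, LinearMap.add_apply, TensorProduct.tmul_add, h₁, h₂]
      | tmul x₁' x₂' =>
      induction y with
      | zero => simp
      | add _ _ h₁ h₂ => simp only [map_add, TensorProduct.add_tmul, h₁, h₂]
      | tmul y₁ y₂ =>
      induction y' with
      | zero => simp
      | add _ _ h₁ h₂ => simp only [map_add, TensorProduct.tmul_add, h₁, h₂]
      | tmul y₁' y₂' => simp
  antipodeT_left a := by
    induction a with
    | zero => simp
    | add _ _ h₁ h₂ => simp only [map_add, add_smul, h₁, h₂]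
    | tmul a₁ a₂ =>
      have h₀ := congrArg₂ (fun x y => x ⊗ₜ[k] y) (antipodeT_left (k := k) a₁)
        (antipodeT_left (k := k) a₂)
      simp only [TensorProduct.comul_tmul, TensorProduct.counit_tmul]
      have h₁ : (Coalgebra.counit (R := k) a₂ • Coalgebra.counit (R := k) a₁) • (1 : H ⊗[k] K)
          = (Coalgebra.counit (R := k) a₁ • (1 : H)) ⊗ₜ[k]
            (Coalgebra.counit (R := k) a₂ • (1 : K)) := by
        rw [TensorProduct.smul_tmul_smul, Algebra.TensorProduct.one_def, smul_eq_mul, mul_comm]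
      rw [h₁, ← h₀]
      generalize Coalgebra.comul (R := k) a₁ = x
      generalize Coalgebra.comul (R := k) a₂ = y
      induction x with
      | zero => simp
      | add _ _ h₁ h₂ => simp only [map_add, TensorProduct.add_tmul, h₁, h₂]
      | tmul x₁ x₂ =>
      induction y with
      | zero => simp
      | add _ _ h₁ h₂ => simp only [map_add, TensorProduct.tmul_add, h₁, h₂]
      | tmul y₁ y₂ => simp
  antipodeT_right a := by
    induction a with
    | zero => simp
    | add _ _ h₁ h₂ => simp only [map_add, add_smul, h₁, h₂]
    | tmul a₁ a₂ =>
      have h₀ := congrArg₂ (fun x y => x ⊗ₜ[k] y) (antipodeT_right (k := k) a₁)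
        (antipodeT_right (k := k) a₂)
      simp only [TensorProduct.comul_tmul, TensorProduct.counit_tmul]
      have h₁ : (Coalgebra.counit (R := k) a₂ • Coalgebra.counit (R := k) a₁) • (1 : H ⊗[k] K)
          = (Coalgebra.counit (R := k) a₁ • (1 : H)) ⊗ₜ[k]
            (Coalgebra.counit (R := k) a₂ • (1 : K)) := by
        rw [TensorProduct.smul_tmul_smul, Algebra.TensorProduct.one_def, smul_eq_mul, mul_comm]
      rw [h₁, ← h₀]
      generalize Coalgebra.comul (R := k) a₁ = x
      generalize Coalgebra.comul (R := k) a₂ = y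
      induction x with
      | zero => simp
      | add _ _ h₁ h₂ => simp only [map_add, TensorProduct.add_tmul, h₁, h₂]
      | tmul x₁ x₂ =>
      induction y with
      | zero => simp
      | add _ _ h₁ h₂ => simp only [map_add, TensorProduct.tmul_add, h₁, h₂]
      | tmul y₁ y₂ => simp
  bullet_mul a b c := by
    induction a with
    | zero => simp
    | add _ _ h₁ h₂ => simp only [map_add, LinearMap.add_apply, h₁, h₂]
    | tmul a₁ a₂ =>
    induction b with
    | zero => simp
    | add _ _ h₁ h₂ =>
      simp only [map_add, add_mul, TensorProduct.map_add_left, LinearMap.add_apply, h₁, h₂]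
    | tmul b₁ b₂ =>
    induction c with
    | zero => simp
    | add _ _ h₁ h₂ =>
      simp only [map_add, mul_add, TensorProduct.map_add_right, LinearMap.comp_add,
        LinearMap.add_apply, h₁, h₂]
    | tmul c₁ c₂ =>
      simp only [Algebra.TensorProduct.tmul_mul_tmul, TensorProduct.map₂_apply_tmul,
        TensorProduct.map_tmul, TensorProduct.comul_tmul, bullet_mul]
      generalize Coalgebra.comul (R := k) a₁ = x
      generalize Coalgebra.comul (R := k) a₂ = y
      induction x with
      | zero => simp
      | add _ _ h₁ h₂ => simp only [map_add, TensorProduct.add_tmul, h₁, h₂]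
      | tmul x₁ x₂ =>
      induction y with
      | zero => simp
      | add _ _ h₁ h₂ => simp only [map_add, TensorProduct.tmul_add, h₁, h₂]
      | tmul y₁ y₂ =>
      simp only [LinearMap.lTensor_tmul, TensorProduct.comul_tmul,
        TensorProduct.AlgebraTensorModule.tensorTensorTensorComm_tmul]
      generalize Coalgebra.comul (R := k) x₂ = z
      generalize Coalgebra.comul (R := k) y₂ = w
      induction z with
      | zero => simp
      | add _ _ h₁ h₂ =>
        simp only [map_add, TensorProduct.add_tmul, TensorProduct.tmul_add, h₁, h₂]
      | tmul z₁ z₂ =>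
      induction w with
      | zero => simp
      | add _ _ h₁ h₂ => simp only [map_add, TensorProduct.tmul_add, h₁, h₂]
      | tmul w₁ w₂ => simp

end Instances

section Product

variable {k : Type u} [Field k] (H K : Type u) [Ring H] [HopfAlgebra k H] [Ring K] [HopfAlgebra k K]
  {L : Type u} [Ring L] [HopfAlgebra k L]

/-- The projection `h ⊗ l ↦ ε(l) h`. -/
noncomputable def fstHom : H ⊗[k] K →ₐc[k] H :=
  (Bialgebra.TensorProduct.rid k k H).toBialgHom.comp
    (Bialgebra.TensorProduct.map (BialgHom.id k H) (Bialgebra.counitBialgHom k K))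

/-- The projection `h ⊗ l ↦ ε(h) l`. -/
noncomputable def sndHom : H ⊗[k] K →ₐc[k] K :=
  (Bialgebra.TensorProduct.lid k K).toBialgHom.comp
    (Bialgebra.TensorProduct.map (Bialgebra.counitBialgHom k H) (BialgHom.id k K))

variable {H K}

/-- The pairing `x ↦ f(x₁) ⊗ g(x₂)`. -/
noncomputable def liftHom [Coalgebra.IsCocomm k L] (f : L →ₐc[k] H) (g : L →ₐc[k] K) :
    L →ₐc[k] H ⊗[k] K :=
  (Bialgebra.TensorProduct.map f g).comp (Bialgebra.comulBialgHom k L)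

theorem fstHom_tmul (h : H) (l : K) :
    fstHom (k := k) H K (h ⊗ₜ[k] l) = Coalgebra.counit (R := k) l • h := rfl

theorem sndHom_tmul (h : H) (l : K) :
    sndHom (k := k) H K (h ⊗ₜ[k] l) = Coalgebra.counit (R := k) h • l := rfl

theorem liftHom_apply [Coalgebra.IsCocomm k L] (f : L →ₐc[k] H) (g : L →ₐc[k] K) (x : L) :
    liftHom f g x = TensorProduct.map (f : L →ₗ[k] H) (g : L →ₗ[k] K)
      (Coalgebra.comul (R := k) x) := rfl

theorem fstHom_bullet [HopfBrace k H] [HopfBrace k K] (a b : H ⊗[k] K) :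
    fstHom (k := k) H K (bullet (k := k) a b)
      = bullet (k := k) (fstHom (k := k) H K a) (fstHom (k := k) H K b) := by
  induction a with
  | zero => simp only [map_zero, LinearMap.zero_apply]
  | add _ _ h₁ h₂ => simp only [map_add, LinearMap.add_apply, h₁, h₂]
  | tmul a₁ a₂ =>
  induction b with
  | zero => simp only [map_zero]
  | add _ _ h₁ h₂ => simp only [map_add, h₁, h₂]
  | tmul b₁ b₂ =>
    have h₁ : bullet (k := k) (a₁ ⊗ₜ[k] a₂) (b₁ ⊗ₜ[k] b₂)
      = bullet (k := k) a₁ b₁ ⊗ₜ[k] bullet (k := k) a₂ b₂ := rfl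
    rw [h₁]
    simp only [fstHom_tmul, counit_bullet, map_smul, LinearMap.smul_apply, mul_smul]
    rw [smul_comm]

theorem sndHom_bullet [HopfBrace k H] [HopfBrace k K] (a b : H ⊗[k] K) :
    sndHom (k := k) H K (bullet (k := k) a b)
      = bullet (k := k) (sndHom (k := k) H K a) (sndHom (k := k) H K b) := by
  induction a with
  | zero => simp only [map_zero, LinearMap.zero_apply]
  | add _ _ h₁ h₂ => simp only [map_add, LinearMap.add_apply, h₁, h₂]
  | tmul a₁ a₂ =>
  induction b with
  | zero => simp only [map_zero]
  | add _ _ h₁ h₂ => simp only [map_add, h₁, h₂]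
  | tmul b₁ b₂ =>
    have h₁ : bullet (k := k) (a₁ ⊗ₜ[k] a₂) (b₁ ⊗ₜ[k] b₂)
      = bullet (k := k) a₁ b₁ ⊗ₜ[k] bullet (k := k) a₂ b₂ := rfl
    rw [h₁]
    simp only [sndHom_tmul, counit_bullet, map_smul, LinearMap.smul_apply, mul_smul]
    rw [smul_comm]

theorem liftHom_bullet [HopfBrace k H] [HopfBrace k K] [HopfBrace k L] [Coalgebra.IsCocomm k L]
    (f : L →ₐc[k] H) (g : L →ₐc[k] K)
    (hf : ∀ a b : L, f (bullet (k := k) a b) = bullet (k := k) (f a) (f b))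
    (hg : ∀ a b : L, g (bullet (k := k) a b) = bullet (k := k) (g a) (g b)) (a b : L) :
    liftHom f g (bullet (k := k) a b)
      = bullet (k := k) (liftHom f g a) (liftHom f g b) := by
  simp only [liftHom_apply, comul_bullet]
  generalize Coalgebra.comul (R := k) a = x
  generalize Coalgebra.comul (R := k) b = y
  induction x with
  | zero => simp only [map_zero, LinearMap.zero_apply]
  | add _ _ h₁ h₂ => simp only [map_add, LinearMap.add_apply, h₁, h₂]
  | tmul x₁ x₂ =>
  induction y with
  | zero => simp only [map_zero]
  | add _ _ h₁ h₂ => simp only [map_add, h₁, h₂]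
  | tmul y₁ y₂ =>
    exact congrArg₂ (fun x y => x ⊗ₜ[k] y) (hf x₁ y₁) (hg x₂ y₂)

theorem fstHom_liftHom [Coalgebra.IsCocomm k L] (f : L →ₐc[k] H) (g : L →ₐc[k] K) (x : L) :
    fstHom (k := k) H K (liftHom f g x) = f x := by
  have h₀ := congrArg (fun t => TensorProduct.rid k H ((f : L →ₗ[k] H).rTensor k t))
    (Coalgebra.lTensor_counit_comul (R := k) x)
  simp only [LinearMap.rTensor_tmul, TensorProduct.rid_tmul, one_smul] at h₀
  refine Eq.trans ?_ h₀
  rw [liftHom_apply]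
  generalize Coalgebra.comul (R := k) x = z
  induction z with
  | zero => simp only [map_zero]
  | add _ _ h₁ h₂ => simp only [map_add, h₁, h₂]
  | tmul z₁ z₂ => simp [fstHom_tmul]

theorem sndHom_liftHom [Coalgebra.IsCocomm k L] (f : L →ₐc[k] H) (g : L →ₐc[k] K) (x : L) :
    sndHom (k := k) H K (liftHom f g x) = g x := by
  have h₀ := congrArg (fun t => TensorProduct.lid k K ((g : L →ₗ[k] K).lTensor k t))
    (Coalgebra.rTensor_counit_comul (R := k) x)
  simp only [LinearMap.lTensor_tmul, TensorProduct.lid_tmul, one_smul] at h₀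
  refine Eq.trans ?_ h₀
  rw [liftHom_apply]
  generalize Coalgebra.comul (R := k) x = z
  induction z with
  | zero => simp only [map_zero]
  | add _ _ h₁ h₂ => simp only [map_add, h₁, h₂]
  | tmul z₁ z₂ => simp [sndHom_tmul]

theorem map_fstHom_sndHom_comul (t : H ⊗[k] K) :
    TensorProduct.map (fstHom (k := k) H K : H ⊗[k] K →ₗ[k] H)
      (sndHom (k := k) H K : H ⊗[k] K →ₗ[k] K) (Coalgebra.comul (R := k) t) = t := by
  induction t with
  | zero => simp only [map_zero]
  | add _ _ h₁ h₂ => simp only [map_add, h₁, h₂]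
  | tmul h l =>
    have h₀ := congrArg₂ (fun x y => TensorProduct.rid k H x ⊗ₜ[k] TensorProduct.lid k K y)
      (Coalgebra.lTensor_counit_comul (R := k) h) (Coalgebra.rTensor_counit_comul (R := k) l)
    simp only [TensorProduct.rid_tmul, TensorProduct.lid_tmul, one_smul] at h₀
    refine Eq.trans ?_ h₀
    rw [TensorProduct.comul_tmul]
    generalize Coalgebra.comul (R := k) h = x
    generalize Coalgebra.comul (R := k) l = y
    induction x with
    | zero => simp only [map_zero, TensorProduct.zero_tmul]
    | add _ _ h₁ h₂ => simp only [map_add, TensorProduct.add_tmul, h₁, h₂]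
    | tmul x₁ x₂ =>
    induction y with
    | zero => simp only [map_zero, TensorProduct.tmul_zero]
    | add _ _ h₁ h₂ => simp only [map_add, TensorProduct.tmul_add, h₁, h₂]
    | tmul y₁ y₂ =>
      refine Eq.trans (b := (Coalgebra.counit (R := k) y₁ • x₁) ⊗ₜ[k]
        (Coalgebra.counit (R := k) x₂ • y₂)) rfl ?_
      simp only [LinearMap.lTensor_tmul, LinearMap.rTensor_tmul, TensorProduct.rid_tmul,
        TensorProduct.lid_tmul, TensorProduct.smul_tmul_smul]
      rw [mul_comm]

theorem liftHom_eq [Coalgebra.IsCocomm k L] (m : L →ₐc[k] H ⊗[k] K) (x : L) :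
    liftHom ((fstHom (k := k) H K).comp m) ((sndHom (k := k) H K).comp m) x = m x := by
  rw [← map_fstHom_sndHom_comul (m x), ← CoalgHomClass.map_comp_comul_apply, liftHom_apply]
  generalize Coalgebra.comul (R := k) x = z
  induction z with
  | zero => simp only [map_zero]
  | add _ _ h₁ h₂ => simp only [map_add, h₁, h₂]
  | tmul z₁ z₂ => rfl

end Product

end HopfBrace

open CategoryTheory

/-- The category of cocommutative Hopf braces over the field `k`. -/
structure HBRcoc (k : Type u) [Field k] where
  /-- The underlying type. -/
  carrier : Type u
  [ring : Ring carrier]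
  [hopfAlgebra : HopfAlgebra k carrier]
  [hopfBrace : HopfBrace k carrier]
  [isCocomm : Coalgebra.IsCocomm k carrier]

namespace HBRcoc

section Category

variable {k : Type u} [Field k]

attribute [instance] ring hopfAlgebra hopfBrace isCocomm

instance : CoeSort (HBRcoc k) (Type u) := ⟨HBRcoc.carrier⟩

/-- Morphisms of Hopf braces: maps of bialgebras for the first structure that also preserve the
second multiplication. -/
@[ext]
structure Hom (H K : HBRcoc k) where
  /-- The underlying map of bialgebras. -/
  toBialgHom : H →ₐc[k] K
  map_bullet : ∀ a b : H,
    toBialgHom (HopfBrace.bullet (k := k) a b)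
      = HopfBrace.bullet (k := k) (toBialgHom a) (toBialgHom b)

instance : Category (HBRcoc k) where
  Hom H K := Hom H K
  id H := ⟨BialgHom.id k H, fun _ _ => rfl⟩
  comp f g := ⟨g.toBialgHom.comp f.toBialgHom, fun a b => by
    simp [f.map_bullet, g.map_bullet]⟩

@[ext]
theorem hom_ext {H K : HBRcoc k} {f g : H ⟶ K} (h : ∀ x, f.toBialgHom x = g.toBialgHom x) :
    f = g :=
  Hom.ext (BialgHom.ext h)

@[simp]
theorem comp_apply {H K L : HBRcoc k} (f : H ⟶ K) (g : K ⟶ L) (x : H) :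
    (f ≫ g).toBialgHom x = g.toBialgHom (f.toBialgHom x) := rfl

@[simp]
theorem id_apply {H : HBRcoc k} (x : H) : (Hom.toBialgHom (𝟙 H)) x = x := rfl

/-- The Hopf brace `k`. -/
noncomputable def unit (k : Type u) [Field k] : HBRcoc k where
  carrier := k

/-- The tensor product of cocommutative Hopf braces. -/
noncomputable def tensor (H K : HBRcoc k) : HBRcoc k where
  carrier := H ⊗[k] K

/-- The counit, as a morphism to the Hopf brace `k`. -/
noncomputable def toUnit (H : HBRcoc k) : H ⟶ unit k where
  toBialgHom := Bialgebra.counitBialgHom k H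
  map_bullet a b := HopfBrace.counit_bullet (k := k) (H := H) a b

/-- The Hopf brace `k` is terminal. -/
noncomputable def isTerminalUnit : Limits.IsTerminal (unit k) :=
  Limits.IsTerminal.ofUniqueHom toUnit fun H f => by
    ext x
    have := CoalgHomClass.counit_comp_apply f.toBialgHom x
    exact this

/-- The projection `h ⊗ l ↦ ε(l) h`. -/
noncomputable def fst (H K : HBRcoc k) : tensor H K ⟶ H where
  toBialgHom := HopfBrace.fstHom H K
  map_bullet := HopfBrace.fstHom_bullet

/-- The projection `h ⊗ l ↦ ε(h) l`. -/
noncomputable def snd (H K : HBRcoc k) : tensor H K ⟶ K where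
  toBialgHom := HopfBrace.sndHom H K
  map_bullet := HopfBrace.sndHom_bullet

/-- The pairing `x ↦ f(x₁) ⊗ g(x₂)`. -/
noncomputable def lift {L H K : HBRcoc k} (f : L ⟶ H) (g : L ⟶ K) : L ⟶ tensor H K where
  toBialgHom := HopfBrace.liftHom f.toBialgHom g.toBialgHom
  map_bullet := HopfBrace.liftHom_bullet _ _ f.map_bullet g.map_bullet

/-- The tensor product is the binary product of cocommutative Hopf braces. -/
noncomputable def isLimitTensor (H K : HBRcoc k) :
    Limits.IsLimit (Limits.BinaryFan.mk (fst H K) (snd H K)) :=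
  Limits.BinaryFan.IsLimit.mk _ (fun f g => lift f g) (fun f g => hom_ext (HopfBrace.fstHom_liftHom _ _))
    (fun f g => hom_ext (HopfBrace.sndHom_liftHom _ _)) (fun f g m hf hg => by
      subst hf hg
      exact hom_ext fun x => (HopfBrace.liftHom_eq m.toBialgHom x).symm)

/-- The cartesian monoidal structure given by the tensor product and the Hopf brace `k`. -/
noncomputable instance : CartesianMonoidalCategory (HBRcoc k) :=
  .ofChosenFiniteProducts ⟨_, isTerminalUnit⟩ fun H K => ⟨_, isLimitTensor H K⟩

noncomputable instance : BraidedCategory (HBRcoc k) := .ofCartesianMonoidalCategory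

end Category

end HBRcoc

/-- An object of a cartesian monoidal category is abelian if it carries the structure of an internal
abelian group. -/
def IsAbelianObject {C : Type*} [Category C] [CartesianMonoidalCategory C] [BraidedCategory C]
    (X : C) : Prop :=
  ∃ _ : GrpObj X, IsCommMonObj X

/-- A functor is an isomorphism of categories if it has a strict two-sided inverse. -/
def IsCategoryIso {C D : Type*} [Category C] [Category D] (F : C ⥤ D) : Prop :=
  ∃ G : D ⥤ C, F ⋙ G = 𝟭 C ∧ G ⋙ F = 𝟭 D

namespace HBRcoc

/-- The two products of `H` coincide. -/
def IsTrivial {k : Type u} [Field k] (H : HBRcoc k) : Prop :=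
  ∀ a b : H, HopfBrace.bullet (k := k) a b = a * b

/-- The product `*` of `H` is commutative. -/
def IsCommutative {k : Type u} [Field k] (H : HBRcoc k) : Prop :=
  ∀ a b : H, a * b = b * a

/-- The trivial cocommutative Hopf braces with commutative product, as a property of objects. -/
def trivialCommutative (k : Type u) [Field k] : ObjectProperty (HBRcoc k) :=
  fun H => H.IsTrivial ∧ H.IsCommutative

/-- The forgetful functor sending a Hopf brace to its first Hopf algebra. -/
noncomputable def toHopfAlgCat (k : Type u) [Field k] : HBRcoc k ⥤ HopfAlgCat.{u} k where
  obj H := HopfAlgCat.of k H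
  map f := HopfAlgCat.ofHom f.toBialgHom

end HBRcoc

/-- The category of commutative and cocommutative Hopf algebras over `k`: the full subcategory of
the category of commutative Hopf algebras on the cocommutative ones. -/
abbrev CommCocommHopf (k : Type u) [Field k] : Type (u + 1) :=
  ObjectProperty.FullSubcategory (C := CommHopfAlgCat.{u} k) fun A => Coalgebra.IsCocomm k A

/-- The forgetful functor from commutative cocommutative Hopf algebras to Hopf algebras. -/
noncomputable def CommCocommHopf.toHopfAlgCat (k : Type u) [Field k] :
    CommCocommHopf k ⥤ HopfAlgCat.{u} k where
  obj A := HopfAlgCat.of k A.obj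
  map f := HopfAlgCat.ofHom f.hom.hom

/-!
The category of cocommutative Hopf braces behaves like the category of groups. The unit object `k`
is both terminal and initial, so there are inclusions `inl : X ⟶ X ⊗ Y` and `inr : Y ⟶ X ⊗ Y`,
given by `x ↦ x ⊗ 1` and `y ↦ 1 ⊗ y`, and they are jointly epic because
`x ⊗ y = (x ⊗ 1) * (1 ⊗ y)` (`tensor_hom_ext`). In such a category a unital multiplication
`m : X ⊗ X ⟶ X` is determined by `inl ≫ m = 𝟙` and `inr ≫ m = 𝟙`; it is automatically associative
and commutative, and every morphism preserves it. So an object carries at most one structure of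
internal group, and the forgetful functor from internal abelian groups is full.

An Eckmann-Hilton argument identifies the objects. If `m` is a unital multiplication on `X`, then
evaluating `m` on the three expressions
`a ⊗ b = (a ⊗ 1) * (1 ⊗ b) = (1 ⊗ b) * (a ⊗ 1) = bullet (a ⊗ 1) (1 ⊗ b)` gives
`a * b = b * a = bullet a b` (`trivialCommutative_of_monObj`). Conversely, if the two products of
`X` coincide and are commutative, the product is a morphism `X ⊗ X ⟶ X`, and the antipode, which is
a bialgebra map because `X` is commutative and cocommutative, is the inverse (`grpObj`).

Hence the forgetful functor is fully faithful and bijective onto the trivial commutative braces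
(`commGrpToFull`). A brace with `bullet = *` is determined by its first Hopf algebra, since `T` is
then another convolution inverse of the identity (`HopfBrace.eq_ofHopfAlgebra`), and this gives the
isomorphism with commutative cocommutative Hopf algebras (`fullToHopf`).
-/

/-! ### The antipode of a commutative cocommutative Hopf algebra -/

open WithConv in
/-- In the convolution group of algebra maps `A → A ⊗ A`, which is commutative since `A` is
cocommutative, `Δ` is the product of the two inclusions `i₁` and `i₂`. Inverting gives
`Δ ∘ S = (i₁ ∘ S) * (i₂ ∘ S) = (S ⊗ S) ∘ Δ`. -/
theorem HopfAlgebra.map_antipodeAlgHom_comp_comulAlgHom (R A : Type*) [CommRing R] [CommRing A]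
    [HopfAlgebra R A] [Coalgebra.IsCocomm R A] :
    (Algebra.TensorProduct.map (antipodeAlgHom R A) (antipodeAlgHom R A)).comp
        (Bialgebra.comulAlgHom R A)
      = (Bialgebra.comulAlgHom R A).comp (antipodeAlgHom R A) := by
  let i₁ : A →ₐ[R] A ⊗[R] A := Algebra.TensorProduct.includeLeft
  let i₂ : A →ₐ[R] A ⊗[R] A := Algebra.TensorProduct.includeRight
  have key (f : A →ₐ[R] A) :
      toConv (i₁.comp f) * toConv (i₂.comp f)
        = toConv ((Algebra.TensorProduct.map f f).comp (Bialgebra.comulAlgHom R A)) := by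
    rw [AlgHom.convMul_def, ← AlgHom.comp_assoc]
    congr 2
    ext <;> simp [i₁, i₂]
  have hinv (f : A →ₐ[R] A ⊗[R] A) :
      (toConv f)⁻¹ = toConv (f.comp (antipodeAlgHom R A)) := rfl
  have h := key (AlgHom.id R A)
  rw [Algebra.TensorProduct.map_id, AlgHom.id_comp, AlgHom.comp_id, AlgHom.comp_id] at h
  refine toConv_injective ?_
  rw [← key, ← hinv, ← hinv, ← hinv, ← h]
  exact (mul_inv (α := WithConv (A →ₐ[R] A ⊗[R] A)) _ _).symm

/-- The antipode of a commutative cocommutative Hopf algebra, as a map of bialgebras. -/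
noncomputable def HopfAlgebra.antipodeBialgHom (R A : Type*) [CommRing R] [CommRing A]
    [HopfAlgebra R A] [Coalgebra.IsCocomm R A] : A →ₐc[R] A :=
  .ofAlgHom (antipodeAlgHom R A) AlgHom.counitAlgHom_comp_antipodeAlgHom
    (map_antipodeAlgHom_comp_comulAlgHom R A)

namespace HBRcoc

variable {k : Type u} [Field k]

open CartesianMonoidalCategory MonoidalCategory MonObj

/-! ### Inclusions into a product -/

theorem hom_from_unit_apply {X : HBRcoc k} (f : 𝟙_ (HBRcoc k) ⟶ X) (c : k) :
    f.toBialgHom c = algebraMap k X c := AlgHomClass.commutes f.toBialgHom c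

/-- The unit object is initial. -/
instance (X : HBRcoc k) : Subsingleton (𝟙_ (HBRcoc k) ⟶ X) :=
  ⟨fun f g => hom_ext fun c => (hom_from_unit_apply f c).trans (hom_from_unit_apply g c).symm⟩

/-- The unit map `k ⟶ X`, the only morphism from the unit object to `X`. -/
noncomputable def zero (X : HBRcoc k) : 𝟙_ (HBRcoc k) ⟶ X where
  toBialgHom := Bialgebra.unitBialgHom k X
  map_bullet (a b : k) := by
    change algebraMap k X (a * b)
      = HopfBrace.bullet (k := k) (algebraMap k X a) (algebraMap k X b)
    simp only [Algebra.algebraMap_eq_smul_one, map_smul, LinearMap.smul_apply,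
      HopfBrace.one_bullet, mul_smul]
    exact smul_comm a b 1

/-- The inclusion `x ↦ x ⊗ 1`, defined as the pairing of the identity and the zero morphism. -/
noncomputable def inl (X Y : HBRcoc k) : X ⟶ X ⊗ Y :=
  CartesianMonoidalCategory.lift (𝟙 X) (CartesianMonoidalCategory.toUnit X ≫ zero Y)

/-- The inclusion `y ↦ 1 ⊗ y`, defined as the pairing of the zero morphism and the identity. -/
noncomputable def inr (X Y : HBRcoc k) : Y ⟶ X ⊗ Y :=
  CartesianMonoidalCategory.lift (CartesianMonoidalCategory.toUnit Y ≫ zero X) (𝟙 Y)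

theorem lift_toBialgHom {L X Y : HBRcoc k} (f : L ⟶ X) (g : L ⟶ Y) :
    (CartesianMonoidalCategory.lift f g).toBialgHom
      = HopfBrace.liftHom f.toBialgHom g.toBialgHom := rfl

theorem toUnit_zero_apply (X Y : HBRcoc k) (x : X) :
    (CartesianMonoidalCategory.toUnit X ≫ zero Y).toBialgHom x
      = Coalgebra.counit (R := k) x • (1 : Y) :=
  (Algebra.algebraMap_eq_smul_one _)

theorem inl_apply (X Y : HBRcoc k) (x : X) :
    (inl X Y).toBialgHom x = (x ⊗ₜ[k] (1 : Y) : X ⊗[k] Y) := by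
  have h₀ := congrArg ((LinearMap.toSpanSingleton k Y 1).lTensor X)
    (Coalgebra.lTensor_counit_comul (R := k) x)
  rw [LinearMap.lTensor_tmul, LinearMap.toSpanSingleton_apply, one_smul] at h₀
  rw [← h₀, inl, lift_toBialgHom]
  refine (HopfBrace.liftHom_apply _ _ _).trans ?_
  generalize Coalgebra.comul (R := k) x = z
  induction z with
  | zero => simp only [map_zero]
  | add _ _ h₁ h₂ => simp only [map_add, h₁, h₂]
  | tmul z₁ z₂ => exact congrArg (z₁ ⊗ₜ[k] ·) (toUnit_zero_apply X Y z₂)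

theorem inr_apply (X Y : HBRcoc k) (y : Y) :
    (inr X Y).toBialgHom y = ((1 : X) ⊗ₜ[k] y : X ⊗[k] Y) := by
  have h₀ := congrArg ((LinearMap.toSpanSingleton k X 1).rTensor Y)
    (Coalgebra.rTensor_counit_comul (R := k) y)
  rw [LinearMap.rTensor_tmul, LinearMap.toSpanSingleton_apply, one_smul] at h₀
  rw [← h₀, inr, lift_toBialgHom]
  refine (HopfBrace.liftHom_apply _ _ _).trans ?_
  generalize Coalgebra.comul (R := k) y = z
  induction z with
  | zero => simp only [map_zero]
  | add _ _ h₁ h₂ => simp only [map_add, h₁, h₂]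
  | tmul z₁ z₂ => exact congrArg (· ⊗ₜ[k] z₂) (toUnit_zero_apply Y X z₁)

theorem inl_mul_inr (X Y : HBRcoc k) (x : X) (y : Y) :
    (inl X Y).toBialgHom x * (inr X Y).toBialgHom y = (x ⊗ₜ[k] y : X ⊗[k] Y) := by
  rw [inl_apply, inr_apply]
  refine (Algebra.TensorProduct.tmul_mul_tmul (R := k) x (1 : X) (1 : Y) y).trans ?_
  rw [_root_.mul_one, _root_.one_mul]

theorem inr_mul_inl (X Y : HBRcoc k) (x : X) (y : Y) :
    (inr X Y).toBialgHom y * (inl X Y).toBialgHom x = (x ⊗ₜ[k] y : X ⊗[k] Y) := by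
  rw [inl_apply, inr_apply]
  refine (Algebra.TensorProduct.tmul_mul_tmul (R := k) (1 : X) x y (1 : Y)).trans ?_
  rw [_root_.mul_one, _root_.one_mul]

theorem inl_bullet_inr (X Y : HBRcoc k) (x : X) (y : Y) :
    HopfBrace.bullet (k := k) ((inl X Y).toBialgHom x) ((inr X Y).toBialgHom y)
      = (x ⊗ₜ[k] y : X ⊗[k] Y) := by
  rw [inl_apply, inr_apply]
  have h : HopfBrace.bullet (k := k) (x ⊗ₜ[k] (1 : Y)) ((1 : X) ⊗ₜ[k] y)
    = HopfBrace.bullet (k := k) x 1 ⊗ₜ[k] HopfBrace.bullet (k := k) 1 y := rfl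
  refine Eq.trans h ?_
  rw [HopfBrace.bullet_one, HopfBrace.one_bullet]

/-- The two inclusions are jointly epic: `x ⊗ y` is the product of their values, and morphisms are
multiplicative. -/
theorem tensor_hom_ext {X Y Z : HBRcoc k} {f g : X ⊗ Y ⟶ Z}
    (hl : inl X Y ≫ f = inl X Y ≫ g) (hr : inr X Y ≫ f = inr X Y ≫ g) : f = g := by
  have hl' (x : X) := congrArg (fun h : X ⟶ Z => h.toBialgHom x) hl
  have hr' (y : Y) := congrArg (fun h : Y ⟶ Z => h.toBialgHom y) hr
  simp only [comp_apply] at hl' hr'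
  refine hom_ext fun t => ?_
  refine TensorProduct.induction_on (R := k) (M := X) (N := Y)
    (motive := fun t => f.toBialgHom t = g.toBialgHom t) t ?_ (fun x y => ?_) (fun s t hs ht => ?_)
  · exact (map_zero f.toBialgHom).trans (map_zero g.toBialgHom).symm
  · rw [← inl_mul_inr, map_mul, map_mul, hl', hr']
  · exact (map_add f.toBialgHom s t).trans
      ((congrArg₂ (· + ·) hs ht).trans (map_add g.toBialgHom s t).symm)


theorem zero_comp {X Y : HBRcoc k} (f : X ⟶ Y) : zero X ≫ f = zero Y :=
  Subsingleton.elim _ _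

theorem inl_tensorHom {X Y X' Y' : HBRcoc k} (f : X ⟶ X') (g : Y ⟶ Y') :
    inl X Y ≫ (f ⊗ₘ g) = f ≫ inl X' Y' := by
  simp [inl, zero_comp]

theorem inr_tensorHom {X Y X' Y' : HBRcoc k} (f : X ⟶ X') (g : Y ⟶ Y') :
    inr X Y ≫ (f ⊗ₘ g) = g ≫ inr X' Y' := by
  simp [inr, zero_comp]

theorem inl_braiding (X Y : HBRcoc k) : inl X Y ≫ (β_ X Y).hom = inr Y X := by
  apply CartesianMonoidalCategory.hom_ext <;> simp [inl, inr]

theorem inr_braiding (X Y : HBRcoc k) : inr X Y ≫ (β_ X Y).hom = inl Y X := by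
  apply CartesianMonoidalCategory.hom_ext <;> simp [inl, inr]

theorem inl_associator (X Y Z : HBRcoc k) :
    inl (X ⊗ Y) Z ≫ (α_ X Y Z).hom = X ◁ inl Y Z := by
  apply CartesianMonoidalCategory.hom_ext
  · simp [inl]
  · apply CartesianMonoidalCategory.hom_ext <;> simp [inl]

theorem inr_associator (X Y Z : HBRcoc k) :
    inr (X ⊗ Y) Z ≫ (α_ X Y Z).hom = inr Y Z ≫ inr X (Y ⊗ Z) := by
  apply CartesianMonoidalCategory.hom_ext
  · simp [inr, zero_comp]
  · apply CartesianMonoidalCategory.hom_ext <;> simp [inr, zero_comp]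

theorem zero_whiskerRight (X Y : HBRcoc k) : zero X ▷ Y = (λ_ Y).hom ≫ inr X Y := by
  apply CartesianMonoidalCategory.hom_ext
  · simp only [inr, whiskerRight_fst, Category.assoc, lift_fst]
    rw [← Category.assoc]
    exact congrArg (· ≫ zero X) (toUnit_unique _ _)
  · simp [inr, leftUnitor_hom]

theorem whiskerLeft_zero (X Y : HBRcoc k) : X ◁ zero Y = (ρ_ X).hom ≫ inl X Y := by
  apply CartesianMonoidalCategory.hom_ext
  · simp [inl, rightUnitor_hom]
  · simp only [inl, whiskerLeft_snd, Category.assoc, lift_snd]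
    rw [← Category.assoc]
    exact congrArg (· ≫ zero Y) (toUnit_unique _ _)

/-! ### Unital multiplications -/

section UnitalMagma

variable {X : HBRcoc k} {m : X ⊗ X ⟶ X} (hl : inl X X ≫ m = 𝟙 X) (hr : inr X X ≫ m = 𝟙 X)
include hl hr

theorem mul_comp_of_unital {Y : HBRcoc k} {n : Y ⊗ Y ⟶ Y} (hl' : inl Y Y ≫ n = 𝟙 Y)
    (hr' : inr Y Y ≫ n = 𝟙 Y) (f : X ⟶ Y) : m ≫ f = (f ⊗ₘ f) ≫ n := by
  apply tensor_hom_ext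
  · rw [reassoc_of% hl, reassoc_of% inl_tensorHom f f, hl', Category.comp_id]
  · rw [reassoc_of% hr, reassoc_of% inr_tensorHom f f, hr', Category.comp_id]

theorem braiding_comp_of_unital : (β_ X X).hom ≫ m = m := by
  apply tensor_hom_ext
  · rw [reassoc_of% inl_braiding X X, hl, hr]
  · rw [reassoc_of% inr_braiding X X, hl, hr]

/-- Both sides are the identity on each of the three inclusions `X ⟶ (X ⊗ X) ⊗ X`; the first two
are treated together, as `inl (X ⊗ X) X`, on which both sides are `m`. -/
theorem assoc_of_unital : (m ▷ X) ≫ m = (α_ X X X).hom ≫ (X ◁ m) ≫ m := by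
  apply tensor_hom_ext
  · rw [← tensorHom_id, reassoc_of% inl_tensorHom m (𝟙 X), hl, Category.comp_id,
      reassoc_of% inl_associator X X X, ← MonoidalCategory.whiskerLeft_comp_assoc, hl,
      MonoidalCategory.whiskerLeft_id, Category.id_comp]
  · rw [← tensorHom_id, reassoc_of% inr_tensorHom m (𝟙 X), hr,
      reassoc_of% inr_associator X X X, ← id_tensorHom, reassoc_of% inr_tensorHom (𝟙 X) m, hr,
      Category.comp_id, hr]

/-- A multiplication for which the zero morphism is a two-sided unit makes `X` a monoid object. -/
@[reducible]
noncomputable def monObjOfUnital : MonObj X where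
  one := zero X
  mul := m
  one_mul := by
    rw [zero_whiskerRight, Category.assoc, hr, Category.comp_id]
  mul_one := by
    rw [whiskerLeft_zero, Category.assoc, hl, Category.comp_id]
  mul_assoc := assoc_of_unital hl hr

end UnitalMagma

theorem inl_mul (X : HBRcoc k) [MonObj X] : inl X X ≫ μ[X] = 𝟙 X := by
  rw [inl, Subsingleton.elim (zero X) η[X], lift_comp_one_right]

theorem inr_mul (X : HBRcoc k) [MonObj X] : inr X X ≫ μ[X] = 𝟙 X := by
  rw [inr, Subsingleton.elim (zero X) η[X], lift_comp_one_left]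

/-- Internal group structures are unique, since the multiplication is determined by its restrictions
along the two inclusions. -/
instance (X : HBRcoc k) : Subsingleton (GrpObj X) := by
  refine ⟨fun G G' => GrpObj.toMonObj_injective (MonObj.ext _ _ ?_)⟩
  apply tensor_hom_ext
  · exact (@inl_mul _ _ X G.toMonObj).trans (@inl_mul _ _ X G'.toMonObj).symm
  · exact (@inr_mul _ _ X G.toMonObj).trans (@inr_mul _ _ X G'.toMonObj).symm

/-- Every morphism between monoid objects is a homomorphism. -/
theorem isMonHom {X Y : HBRcoc k} [MonObj X] [MonObj Y] (f : X ⟶ Y) : IsMonHom f where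
  one_hom := Subsingleton.elim _ _
  mul_hom := mul_comp_of_unital (inl_mul X) (inr_mul X) (inl_mul Y) (inr_mul Y) f

/-! ### Abelian objects are the trivial commutative braces -/

section

variable (X : HBRcoc k) [MonObj X]

theorem inl_mul_apply (x : X) : μ[X].toBialgHom ((inl X X).toBialgHom x) = x :=
  congrArg (fun h : X ⟶ X => h.toBialgHom x) (inl_mul X)

theorem inr_mul_apply (x : X) : μ[X].toBialgHom ((inr X X).toBialgHom x) = x :=
  congrArg (fun h : X ⟶ X => h.toBialgHom x) (inr_mul X)

/-- The Eckmann-Hilton argument: the internal multiplication restricts to the identity along both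
inclusions and preserves `*` and `bullet`, and `x ⊗ y` is the product of `x ⊗ 1` and `1 ⊗ y` in
either order and for either product. -/
theorem trivialCommutative_of_monObj : trivialCommutative k X := by
  have h₁ (a b : X) : μ[X].toBialgHom (a ⊗ₜ[k] b : X ⊗[k] X) = a * b := by
    rw [← inl_mul_inr, map_mul, inl_mul_apply, inr_mul_apply]
  refine ⟨fun a b => ?_, fun a b => ?_⟩
  · rw [← h₁, ← inl_bullet_inr, μ[X].map_bullet, inl_mul_apply, inr_mul_apply]
  · rw [← h₁, ← inr_mul_inl, map_mul, inl_mul_apply, inr_mul_apply]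

end

section

variable {X : HBRcoc k} (hX : trivialCommutative k X)
include hX

/-- The commutative ring structure that extends the given ring structure. -/
@[reducible]
noncomputable def commRing : CommRing X :=
  { X.ring with mul_comm := hX.2 }

/-- The product of a trivial commutative brace, as a morphism. -/
noncomputable def mulHom : X ⊗ X ⟶ X where
  toBialgHom :=
    letI := commRing hX
    Bialgebra.mulBialgHom k X
  map_bullet s t := by
    let _ := commRing hX
    change LinearMap.mul' k X (HopfBrace.bullet (k := k) (H := X ⊗[k] X) s t)
      = HopfBrace.bullet (k := k) (LinearMap.mul' k X s) (LinearMap.mul' k X t)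
    have h : (HopfBrace.bullet (k := k) (H := X ⊗[k] X)) = LinearMap.mul k (X ⊗[k] X) := by
      refine TensorProduct.ext' fun a b => TensorProduct.ext' fun c d => ?_
      exact (congrArg₂ (· ⊗ₜ[k] ·) (hX.1 a c) (hX.1 b d)).trans
        (Algebra.TensorProduct.tmul_mul_tmul (R := k) a c b d).symm
    rw [h, hX.1]
    exact map_mul (Algebra.TensorProduct.lmul' k (S := X)) s t

/-- The antipode of a trivial commutative brace, as a morphism. -/
noncomputable def antipodeHom : X ⟶ X where
  toBialgHom :=
    letI := commRing hX
    HopfAlgebra.antipodeBialgHom k X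
  map_bullet a b := by
    let _ := commRing hX
    rw [hX.1, hX.1]
    exact map_mul (HopfAlgebra.antipodeBialgHom k X) a b

theorem inl_mulHom : inl X X ≫ mulHom hX = 𝟙 X := by
  refine hom_ext fun x => ?_
  rw [comp_apply, inl_apply]
  exact _root_.mul_one x

theorem inr_mulHom : inr X X ≫ mulHom hX = 𝟙 X := by
  refine hom_ext fun x => ?_
  rw [comp_apply, inr_apply]
  exact _root_.one_mul x

/-- The internal group structure of a trivial commutative brace, given by product and antipode. -/
@[reducible]
noncomputable def grpObj : GrpObj X where
  toMonObj := monObjOfUnital (inl_mulHom hX) (inr_mulHom hX)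
  inv := antipodeHom hX
  left_inv := hom_ext fun x => HopfAlgebra.mul_antipode_rTensor_comul_apply (R := k) x
  right_inv := hom_ext fun x => HopfAlgebra.mul_antipode_lTensor_comul_apply (R := k) x

theorem isCommMonObj : letI := grpObj hX; IsCommMonObj X :=
  letI := grpObj hX
  ⟨braiding_comp_of_unital (inl_mulHom hX) (inr_mulHom hX)⟩

end

end HBRcoc

/-! ### Isomorphisms of categories -/

theorem CategoryTheory.Functor.IsIso.isCategoryIso {C D : Type*} [Category C] [Category D]
    (F : C ⥤ D) [F.IsIso] : IsCategoryIso F :=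
  ⟨F.asIsomorphism.inverse, F.asIsomorphism.unit_eq.symm, F.asIsomorphism.counit_eq⟩

/-- If `bullet = *`, then `T` is a convolution inverse of the identity, hence equal to `S`. -/
theorem HopfBrace.eq_ofHopfAlgebra {k H : Type u} [Field k] [Ring H] [HopfAlgebra k H]
    (B : HopfBrace k H) (h : B.bullet = LinearMap.mul k H) : B = HopfBrace.ofHopfAlgebra H := by
  have hT : B.antipodeT = HopfAlgebra.antipode k := by
    apply WithConv.toConv_injective
    refine left_inv_eq_right_inv (a := WithConv.toConv LinearMap.id) ?_
      LinearMap.id_mul_antipode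
    ext a
    have ha := B.antipodeT_left a
    rw [h, ← Algebra.algebraMap_eq_smul_one] at ha
    exact ha
  cases B
  subst h hT
  rfl

namespace HBRcoc

variable (k : Type u) [Field k]

theorem isAbelianObject_iff (H : HBRcoc k) :
    IsAbelianObject H ↔ H.IsTrivial ∧ H.IsCommutative :=
  ⟨fun ⟨_, _⟩ => trivialCommutative_of_monObj H, fun h => ⟨grpObj h, isCommMonObj h⟩⟩

/-- The functor that forgets the internal group structure, with values in the trivial commutative
braces. -/
noncomputable def commGrpToFull : CommGrp (HBRcoc k) ⥤ (trivialCommutative k).FullSubcategory :=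
  (trivialCommutative k).lift (CommGrp.forget _) fun A => trivialCommutative_of_monObj A.X

instance : (commGrpToFull k).IsIso where
  faithful := ⟨fun {A B f g} h => by
    have h' : ((commGrpToFull k).map f).hom = ((commGrpToFull k).map g).hom :=
      congrArg InducedCategory.Hom.hom h
    exact (CommGrp.forget (HBRcoc k)).map_injective h'⟩
  full := ⟨fun {A B} f =>
    let g : A.X ⟶ B.X := f.hom
    have := isMonHom g
    ⟨InducedCategory.homMk (Grp.homMk' (Mon.Hom.mk g)), rfl⟩⟩
  bijective_obj := by
    refine ⟨fun A B h => ?_, fun ⟨X, hX⟩ => ?_⟩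
    · obtain @⟨X, G, _⟩ := A
      obtain @⟨Y, G', _⟩ := B
      obtain rfl : X = Y := congrArg ObjectProperty.FullSubcategory.obj h
      obtain rfl : G = G' := Subsingleton.elim _ _
      rfl
    · exact ⟨@CommGrp.mk _ _ _ _ X (grpObj hX) (isCommMonObj hX), rfl⟩

/-- The functor from trivial commutative braces to commutative cocommutative Hopf algebras that
forgets `bullet` and `T`. -/
noncomputable def fullToHopf : (trivialCommutative k).FullSubcategory ⥤ CommCocommHopf k where
  obj X := ⟨@CommHopfAlgCat.of k _ X.obj (commRing X.property) X.obj.hopfAlgebra, X.obj.isCocomm⟩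
  map {X Y} f := ObjectProperty.homMk
    (@CommHopfAlgCat.ofHom k _ X.obj Y.obj (commRing X.property) (commRing Y.property) _ _
      f.hom.toBialgHom)

instance : (fullToHopf k).IsIso where
  faithful := ⟨fun {X Y f g} h => by
    apply ObjectProperty.hom_ext
    apply hom_ext
    intro x
    have := congrArg (fun t => t.hom.hom x) h
    exact this⟩
  full := ⟨fun {X Y} f => ⟨ObjectProperty.homMk ⟨f.hom.hom, fun a b => by
    rw [X.property.1, Y.property.1]; exact map_mul f.hom.hom a b⟩, rfl⟩⟩
  bijective_obj := by
    -- The inverse equips a Hopf algebra with the brace whose two products coincide; passing from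
    -- `CommRing` to `Ring` and back is the identity by eta for structures.
    refine Function.bijective_iff_has_inverse.mpr ⟨fun A =>
      ⟨@HBRcoc.mk k _ A.obj _ _ (HopfBrace.ofHopfAlgebra A.obj) A.property,
        fun _ _ => rfl, fun a b => mul_comm (G := A.obj) a b⟩, fun X => ?_, fun A => rfl⟩
    obtain ⟨@⟨H, _, _, B, _⟩, hX⟩ := X
    obtain rfl := B.eq_ofHopfAlgebra (LinearMap.ext₂ hX.1)
    rfl
end HBRcoc

theorem proposition4p4 (k : Type u) [Field k] :
    -- the abelian objects
    (∀ H : HBRcoc k, IsAbelianObject H ↔ H.IsTrivial ∧ H.IsCommutative) ∧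
    -- as a category, `Ab` is the full subcategory of trivial Hopf braces with commutative product
    (∃ E : CommGrp (HBRcoc k) ⥤ (HBRcoc.trivialCommutative k).FullSubcategory,
      IsCategoryIso E ∧
      E ⋙ (HBRcoc.trivialCommutative k).ι = CommGrp.forget (HBRcoc k)) ∧
    -- `Ab` is isomorphic to the category of commutative cocommutative Hopf algebras
    (∃ F : CommGrp (HBRcoc k) ⥤ CommCocommHopf k,
      IsCategoryIso F ∧
      F ⋙ CommCocommHopf.toHopfAlgCat k
        = CommGrp.forget (HBRcoc k) ⋙ HBRcoc.toHopfAlgCat k) := by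
  refine ⟨HBRcoc.isAbelianObject_iff k,
    ⟨HBRcoc.commGrpToFull k, Functor.IsIso.isCategoryIso _, rfl⟩,
    ⟨HBRcoc.commGrpToFull k ⋙ HBRcoc.fullToHopf k, Functor.IsIso.isCategoryIso _, rfl⟩⟩
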